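/- Let $q>3$ be a prime power, let $m\ge q$, and write $m-1=a(q-1)+b$ with integers $a\ge 1$ and $0\le b\le q-2$. Put $n=\frac{q^m-1}{q-1}$, let $\alpha$ be a primitive element of $\mathbb{F}_{q^m}$ and $\theta=\alpha^{q-1}$, a primitive $n$-th root of unity. For $i\ge 0$ let $m_i(x)$ be the minimal polynomial of $\theta^i$ over $\mathbb{F}_q$. For $1\le\delta<n$ let $\widehat{\mathcal C}_{(q,m,q-1,\delta)}$ be the cyclic code of length $n$ over $\mathbb{F}_q$ with generator polynomial $\mathrm{lcm}(m_0(x),m_1(x),\ldots,m_{\delta-1}(x))$. The coset leader of the $q$-cyclotomic coset $\{iq^j \bmod n : j\ge 0\}$ of $i$ ($0\le i\le n-1$) is its smallest element. If $b=0$, let $$\delta=\frac{q^m-1-q^{m-1}-\sum_{\ell=1}^{q-2}q^{a\ell}}{q-1};$$ if $b=1$, let $A=\lfloor\frac{q-1}{2}\rfloor$ and $$\delta=\frac{q^m-1-q^{m-1}-\sum_{\ell=1}^{A}q^{a\ell}-\sum_{\ell=A+1}^{q-2}q^{a\ell+1}}{q-1}.$$ In both cases $\delta$ is the largest $q$-cyclotomic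 coset leader modulo $n$, and the following holds. (i) If $b=0$, or if $b=1$ and $q$ is even, then $\widehat{\mathcal C}_{(q,m,q-1,\delta)}$ is a one-weight code (all its nonzero codewords have the same Hamming weight) with length $n=\frac{q^m-1}{q-1}$, dimension $m$ and minimum distance $q^{m-1}$. (ii) If $b=1$ and $q$ is odd, then $\widehat{\mathcal C}_{(q,m,q-1,\delta)}$ is a one-weight code with length $\frac{q^m-1}{q-1}$, dimension $\frac m2$ and minimum distance $(q^{m/2}+1)q^{m/2-1}$. -/

import Mathlib

open Polynomial

noncomputable section

/-- The `q`-cyclotomic coset of `i` modulo `n`, as a set of residues in `{0, …, n - 1}`. -/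
def cyclotomicCoset (q n i : ℕ) : Set ℕ :=
  {s | ∃ j : ℕ, s = i * q ^ j % n}

/-- `i ∈ {0, …, n - 1}` is the smallest element of its `q`-cyclotomic coset modulo `n`. -/
def IsCosetLeader (q n i : ℕ) : Prop :=
  i < n ∧ IsLeast (cyclotomicCoset q n i) i

/-- The polynomial `c₀ + c₁ x + ⋯ + c_{n-1} x^{n-1}` of a word `c` of length `n`. -/
def wordPoly {F : Type*} [Field F] {n : ℕ} (c : Fin n → F) : F[X] :=
  ∑ i : Fin n, C (c i) * X ^ (i : ℕ)

/-- The code of length `n` with generator polynomial `g` (a divisor of `x ^ n - 1`):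
the words whose polynomial is a multiple of `g`. -/
def codeOfGenerator {F : Type*} [Field F] (n : ℕ) (g : F[X]) : Submodule F (Fin n → F) where
  carrier := {c | g ∣ wordPoly c}
  add_mem' {c d} hc hd := by
    have h : wordPoly (c + d) = wordPoly c + wordPoly d := by
      simp [wordPoly, add_mul, Finset.sum_add_distrib]
    simpa only [Set.mem_ofPred_eq, h] using dvd_add hc hd
  zero_mem' := by simp [wordPoly]
  smul_mem' a c hc := by
    have h : wordPoly (a • c) = C a * wordPoly c := by
      simp [wordPoly, Finset.mul_sum, mul_assoc]
    simpa only [Set.mem_ofPred_eq, h] using Dvd.dvd.mul_left hc (C a)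

/-- The monic least common multiple of the minimal polynomials over `F` of
`θ ^ b, θ ^ (b + 1), …, θ ^ (b + δ - 2)`. -/
def bchGenerator (F : Type*) [Field F] {K : Type*} [Field K] [Algebra F K]
    (θ : K) (δ b : ℕ) : F[X] :=
  letI : DecidableEq F := Classical.decEq F
  letI : NormalizedGCDMonoid F[X] := UniqueFactorizationMonoid.toNormalizedGCDMonoid F[X]
  (Finset.range (δ - 1)).lcm fun j => minpoly F (θ ^ (b + j))

/-- The BCH code `C_(q,m,lam,δ,b)` over `F = 𝔽_q`, of length `(q ^ m - 1) / lam` and designed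
distance `δ`, built from the element `α` of `K = 𝔽_(q^m)` (meant to be a primitive element). -/
def bchCode (F : Type*) [Field F] {K : Type*} [Field K] [Algebra F K]
    (α : K) (q m lam δ b : ℕ) : Submodule F (Fin ((q ^ m - 1) / lam) → F) :=
  codeOfGenerator ((q ^ m - 1) / lam) (bchGenerator F (α ^ lam) δ b)

/-- `Ĉ_(q,m,lam,δ) = C_(q,m,lam,δ+1,0)`. -/
def bchCodeHat (F : Type*) [Field F] {K : Type*} [Field K] [Algebra F K]
    (α : K) (q m lam δ : ℕ) : Submodule F (Fin ((q ^ m - 1) / lam) → F) :=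
  bchCode F α q m lam (δ + 1) 0

/-- `c` is an `[n, k, d]` linear code: dimension `k` and minimum Hamming distance `d`. -/
def HasParameters {F : Type*} [Field F] [DecidableEq F] {n : ℕ}
    (c : Submodule F (Fin n → F)) (k d : ℕ) : Prop :=
  Module.finrank F c = k ∧
    IsLeast {w : ℕ | ∃ x ∈ c, ∃ y ∈ c, x ≠ y ∧ hammingDist x y = w} d

/-- The nonzero codewords have exactly one Hamming weight. -/
def IsOneWeight {F : Type*} [Field F] [DecidableEq F] {n : ℕ}
    (c : Submodule F (Fin n → F)) : Prop :=
  ∃ w : ℕ, {v : ℕ | ∃ x ∈ c, x ≠ 0 ∧ hammingNorm x = v} = {w}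

/-- `(q^m - 1 - q^(m-1) - ∑_{ℓ=1}^{q-2} q^(aℓ)) / (q - 1)`. For `q > 3` and `m = a(q-1) + 1` with
`a ≥ 1`, no subtraction truncates and the division is exact. -/
def deltaZero (q m a : ℕ) : ℕ :=
  (q ^ m - 1 - q ^ (m - 1) - ∑ l ∈ Finset.Icc 1 (q - 2), q ^ (a * l)) / (q - 1)

/-- `(q^m - 1 - q^(m-1) - ∑_{ℓ=1}^{A} q^(aℓ) - ∑_{ℓ=A+1}^{q-2} q^(aℓ+1)) / (q - 1)` with
`A = ⌊(q-1)/2⌋`. For `q > 3` and `m = a(q-1) + 2` with `a ≥ 1`, no subtraction truncates and the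
division is exact. -/
def deltaOne (q m a : ℕ) : ℕ :=
  (q ^ m - 1 - q ^ (m - 1) - ∑ l ∈ Finset.Icc 1 ((q - 1) / 2), q ^ (a * l)
    - ∑ l ∈ Finset.Icc ((q - 1) / 2 + 1) (q - 2), q ^ (a * l + 1)) / (q - 1)

end

/-! Coset leaders are studied through complements. Put `n = (q ^ m - 1) / (q - 1)` and let `R s = n
- (t * q ^ s mod n)`. Then `(q - 1) * R s` is the base-`q` value of an `m`-digit word, and passing
from `s` to `s + 1` rotates the word. A large smallest element of the coset means that every
rotation has a small value. Since `q ≡ 1` modulo `q - 1`, the digit sum is a positive multiple of `q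
- 1`, so at least `q - 1`. By the cycle lemma some rotation has all its partial sums above the line
of slope `(q - 1) / m`. Its partial sums then dominate those of the upper Christoffel word, hence so
does its value. Conversely, subadditivity of ceilings makes the Christoffel word the largest of its
own rotations. So the largest leader `δ` satisfies `(q - 1) * δ + christoffelValue q m = q ^ m - 1`,
and both formulas for `δ` are evaluations of this Christoffel value.

The zeros of the code then cover every coset except that of `δ`, so evaluation at `ζ = θ ^ δ` is
injective on the code. Rotating a word multiplies this evaluation by a power of `ζ⁻¹`. If the
scalars and `ζ⁻¹` generate `F(ζ)ˣ`, every nonzero codeword is a scalar multiple of a rotation of one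
fixed word, which gives a single weight, found by double counting. Here `ζ⁻¹ = α ^ christoffelValue
q m`, and generation reduces to the coprimality of an exponent with `1 + q + ⋯ + q ^ (h - 1)`. For
`b = 1` and `q` odd the Christoffel value has the factor `q ^ (m / 2) + 1`, so `ζ` lies in the
subfield of degree `h = m / 2`; otherwise `h = m`. -/

open scoped IntermediateField

/-! ### Base-`q` values, domination by partial sums, and the cycle lemma -/

/-- The value in base `q` of the word `f 0, f 1, …, f (l - 1)`, most significant digit first. -/
def hornerVal (q : ℤ) (f : ℕ → ℤ) : ℕ → ℤ
  | 0 => 0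
  | l + 1 => q * hornerVal q f l + f l

theorem hornerVal_succ_front (q : ℤ) (f : ℕ → ℤ) (l : ℕ) :
    hornerVal q f (l + 1) = f 0 * q ^ l + hornerVal q (fun j => f (j + 1)) l := by
  induction l with
  | zero => simp [hornerVal]
  | succ l ih =>
    rw [hornerVal, ih, hornerVal]
    ring

/-- Bounding the gap in value below by the gap in digit sums, rather than by zero, makes the
induction close: the next digit may lower the gap, but the earlier gap is nonnegative and is
multiplied by `q ≥ 1`. Digits may be arbitrary integers. -/
theorem hornerVal_sub_le {q : ℤ} (hq : 1 ≤ q) {f g : ℕ → ℤ} {l : ℕ}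
    (h : ∀ t ≤ l, ∑ j ∈ Finset.range t, f j ≤ ∑ j ∈ Finset.range t, g j) :
    ∑ j ∈ Finset.range l, g j - ∑ j ∈ Finset.range l, f j ≤ hornerVal q g l - hornerVal q f l := by
  induction l with
  | zero => simp [hornerVal]
  | succ l ih =>
    have h1 := ih fun t ht => h t (ht.trans l.le_succ)
    have h2 := h l l.le_succ
    rw [hornerVal, hornerVal, Finset.sum_range_succ, Finset.sum_range_succ]
    nlinarith

theorem hornerVal_mono {q : ℤ} (hq : 1 ≤ q) {f g : ℕ → ℤ} {l : ℕ}
    (h : ∀ t ≤ l, ∑ j ∈ Finset.range t, f j ≤ ∑ j ∈ Finset.range t, g j) :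
    hornerVal q f l ≤ hornerVal q g l := by
  have h1 := hornerVal_sub_le hq h
  have h2 := h l le_rfl
  linarith

theorem hornerVal_modEq_sum (q : ℤ) (f : ℕ → ℤ) (l : ℕ) :
    hornerVal q f l ≡ ∑ j ∈ Finset.range l, f j [ZMOD q - 1] := by
  induction l with
  | zero => rfl
  | succ l ih =>
    rw [hornerVal, Finset.sum_range_succ]
    refine Int.ModEq.add ?_ rfl
    have hq : q ≡ 1 [ZMOD q - 1] := (Int.modEq_iff_dvd.2 ⟨-1, by ring⟩)
    simpa using hq.mul ih

/-- Digit expansion of an orbit of multiplication by `q` modulo `n`. -/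
theorem pow_mul_sub_eq_hornerVal {q n : ℤ} {R d : ℕ → ℤ}
    (h : ∀ j, q * R j - R (j + 1) = n * d j) (s l : ℕ) :
    q ^ l * R s - R (s + l) = n * hornerVal q (fun j => d (s + j)) l := by
  induction l with
  | zero => simp [hornerVal]
  | succ l ih =>
    have h1 := h (s + l)
    rw [hornerVal, ← add_assoc]
    linear_combination q * ih + h1

/-- Cycle lemma: a sequence whose partial sums gain at least `r` over a period `m` has a
starting point from which all partial sums lie above the line of slope `r / m`. -/
theorem exists_start_partialSum_ge {m : ℕ} (hm : 0 < m) {r : ℤ} {d : ℕ → ℤ}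
    (hper : ∀ j, d (j + m) = d j) (hsum : r ≤ ∑ j ∈ Finset.range m, d j) :
    ∃ s, ∀ l ≤ m, r * l ≤ m * ∑ j ∈ Finset.range l, d (s + j) := by
  -- `G` is the scaled height of the partial sums above the line. A full period does not lower it,
  -- so a minimum over one period also bounds the next.
  let G : ℕ → ℤ := fun t => m * ∑ j ∈ Finset.range t, d j - r * t
  obtain ⟨s, hs, hmin⟩ := Finset.exists_min_image (Finset.range m) G ⟨0, by simpa using hm⟩
  refine ⟨s, fun l hl => ?_⟩
  have hG : G s ≤ G (s + l) := by
    rcases lt_or_ge (s + l) m with h | h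
    · exact hmin _ (Finset.mem_range.2 h)
    · obtain ⟨t, ht⟩ := Nat.exists_eq_add_of_le' h
      have htm : t < m := by rw [Finset.mem_range] at hs; omega
      refine (hmin t (Finset.mem_range.2 htm)).trans ?_
      have hm' : (0 : ℤ) < m := by exact_mod_cast hm
      simp only [G, ht]
      rw [add_comm t m, Finset.sum_range_add]
      simp only [add_comm m, hper]
      push_cast
      nlinarith
  simp only [G, Finset.sum_range_add] at hG
  push_cast at hG
  linarith

/-! ### Christoffel words -/

/-- The number of ones among the first `l` letters of the upper Christoffel word with `r` ones
and length `m`. -/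
def christoffelCount (r m l : ℕ) : ℕ := (l * r) ⌈/⌉ m

/-- The letters of the periodic upper Christoffel word of slope `r / m`. -/
def christoffelDigit (r m j : ℕ) : ℤ :=
  christoffelCount r m (j + 1) - christoffelCount r m j

section christoffel

variable {r m : ℕ}

theorem christoffelCount_le_iff (hm : 0 < m) {l k : ℕ} :
    christoffelCount r m l ≤ k ↔ l * r ≤ m * k := by
  rw [christoffelCount, ceilDiv_le_iff_le_mul hm]

theorem le_mul_christoffelCount (hm : 0 < m) (l : ℕ) : l * r ≤ m * christoffelCount r m l :=
  (christoffelCount_le_iff hm).1 le_rfl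

theorem christoffelCount_zero (hm : 0 < m) : christoffelCount r m 0 = 0 :=
  Nat.le_zero.1 ((christoffelCount_le_iff hm).2 (by simp))

theorem christoffelCount_add_le (hm : 0 < m) (s l : ℕ) :
    christoffelCount r m (s + l) ≤ christoffelCount r m s + christoffelCount r m l := by
  rw [christoffelCount_le_iff hm]
  nlinarith [le_mul_christoffelCount (r := r) hm s, le_mul_christoffelCount (r := r) hm l]

theorem christoffelCount_add_period (hm : 0 < m) (l : ℕ) :
    christoffelCount r m (l + m) = christoffelCount r m l + r := by
  refine le_antisymm ?_ ?_
  · rw [christoffelCount_le_iff hm]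
    nlinarith [le_mul_christoffelCount (r := r) hm l]
  · have h := le_mul_christoffelCount (r := r) hm (l + m)
    have hr : r ≤ christoffelCount r m (l + m) := by
      refine Nat.le_of_mul_le_mul_left (le_trans ?_ h) hm
      nlinarith
    obtain ⟨t, ht⟩ := Nat.exists_eq_add_of_le' hr
    rw [ht] at h ⊢
    refine Nat.add_le_add_right ((christoffelCount_le_iff hm).2 ?_) r
    nlinarith

theorem christoffelCount_period (hm : 0 < m) : christoffelCount r m m = r := by
  simpa [christoffelCount_zero hm] using christoffelCount_add_period (r := r) hm 0

theorem lt_christoffelCount_iff (hm : 0 < m) (hr : 0 < r) {l k : ℕ} :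
    k < christoffelCount r m l ↔ k * m / r < l := by
  rw [← not_le, christoffelCount_le_iff hm, not_le, Nat.div_lt_iff_lt_mul hr, mul_comm m]

theorem christoffelCount_mono (hm : 0 < m) : Monotone (christoffelCount r m) := by
  intro s t h
  rw [christoffelCount_le_iff hm]
  exact (Nat.mul_le_mul_right r h).trans (le_mul_christoffelCount hm t)

theorem sum_christoffelDigit (s l : ℕ) :
    ∑ j ∈ Finset.range l, christoffelDigit r m (s + j) =
      christoffelCount r m (s + l) - christoffelCount r m s := by
  induction l with
  | zero => simp
  | succ l ih =>
    rw [Finset.sum_range_succ, ih, christoffelDigit, ← add_assoc]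
    ring

theorem sum_christoffelDigit_zero (hm : 0 < m) (l : ℕ) :
    ∑ j ∈ Finset.range l, christoffelDigit r m j = christoffelCount r m l := by
  simpa [christoffelCount_zero hm] using sum_christoffelDigit (r := r) (m := m) 0 l

theorem christoffelDigit_add_period (hm : 0 < m) (j : ℕ) :
    christoffelDigit r m (j + m) = christoffelDigit r m j := by
  rw [christoffelDigit, add_right_comm, christoffelCount_add_period hm,
    christoffelCount_add_period hm, christoffelDigit]
  push_cast
  ring

/-- By `lt_christoffelCount_iff`, the `k`-th one, counted from zero, sits at index `⌊k * m / r⌋`. -/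
theorem hornerVal_christoffelDigit_eq_sum (q : ℕ) (hm : 0 < m) (hr : 0 < r) (l : ℕ) :
    hornerVal q (christoffelDigit r m) l =
      ((∑ k ∈ Finset.range (christoffelCount r m l), q ^ (l - 1 - k * m / r) : ℕ) : ℤ) := by
  induction l with
  | zero => simp [hornerVal, christoffelCount_zero hm]
  | succ l ih =>
    have hle := christoffelCount_mono (r := r) hm l.le_succ
    rw [hornerVal, ih, christoffelDigit, ← Finset.sum_range_add_sum_Ico _ hle]
    have h1 : ∑ k ∈ Finset.Ico (christoffelCount r m l) (christoffelCount r m (l + 1)),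
        q ^ (l + 1 - 1 - k * m / r) =
        christoffelCount r m (l + 1) - christoffelCount r m l := by
      rw [Finset.sum_congr rfl (g := fun _ => 1)]
      · simp
      · intro k hk
        rw [Finset.mem_Ico, lt_christoffelCount_iff hm hr, ← not_lt,
          lt_christoffelCount_iff hm hr] at hk
        rw [show l + 1 - 1 - k * m / r = 0 by omega, pow_zero]
    have h2 : ∑ k ∈ Finset.range (christoffelCount r m l), q ^ (l + 1 - 1 - k * m / r) =
        q * ∑ k ∈ Finset.range (christoffelCount r m l), q ^ (l - 1 - k * m / r) := by
      rw [Finset.mul_sum]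
      refine Finset.sum_congr rfl fun k hk => ?_
      rw [Finset.mem_range, lt_christoffelCount_iff hm hr] at hk
      rw [← pow_succ']
      congr 1
      omega
    rw [h1, h2]
    push_cast [Nat.cast_sub hle]
    ring

end christoffel

/-! ### The largest coset leader -/

/-- The value in base `q` of the upper Christoffel word with `q - 1` ones and length `m`. -/
def christoffelValue (q m : ℕ) : ℕ := ∑ k ∈ Finset.range (q - 1), q ^ (m - 1 - k * m / (q - 1))

section leader

variable {q m n : ℕ}

theorem hornerVal_christoffelDigit (hq : 2 ≤ q) (hm : 0 < m) :
    hornerVal q (christoffelDigit (q - 1) m) m = (christoffelValue q m : ℤ) := by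
  rw [hornerVal_christoffelDigit_eq_sum q hm (by omega), christoffelCount_period hm,
    christoffelValue]

/-- Subadditivity of `l ↦ ⌈l * r / m⌉` says that partial sums from any starting point are at most
those from the origin. -/
theorem hornerVal_rotate_christoffelDigit_le (hq : 2 ≤ q) (hm : 0 < m) (s : ℕ) :
    hornerVal q (fun j => christoffelDigit (q - 1) m (s + j)) m ≤ christoffelValue q m := by
  rw [← hornerVal_christoffelDigit hq hm]
  refine hornerVal_mono (by exact_mod_cast (by omega : 1 ≤ q)) fun t _ => ?_
  rw [sum_christoffelDigit, sum_christoffelDigit_zero hm]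
  have := christoffelCount_add_le (r := q - 1) hm s t
  push_cast [← Nat.cast_le (α := ℤ)] at this
  linarith

theorem hornerVal_rotate_christoffelDigit_pos (hq : 2 ≤ q) (hm : 0 < m) (s : ℕ) :
    0 < hornerVal q (fun j => christoffelDigit (q - 1) m (s + j)) m := by
  have h := hornerVal_sub_le (q := q) (f := fun _ => 0)
    (g := fun j => christoffelDigit (q - 1) m (s + j)) (l := m)
    (by exact_mod_cast (by omega : 1 ≤ q)) fun t _ => by
      rw [sum_christoffelDigit]
      have := christoffelCount_mono (r := q - 1) hm (Nat.le_add_right s t)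
      push_cast [← Nat.cast_le (α := ℤ)] at this
      simpa using this
  have h0 : hornerVal q (fun _ => 0) m = 0 := by
    clear h hm
    induction m with
    | zero => rfl
    | succ m ih => simp [hornerVal, ih]
  rw [sum_christoffelDigit, christoffelCount_add_period hm, h0] at h
  have : (0 : ℤ) < ((q - 1 : ℕ) : ℤ) := by exact_mod_cast (by omega)
  push_cast at h
  simp only [Finset.sum_const_zero] at h
  linarith

theorem hornerVal_rotate_christoffelDigit_step (hm : 0 < m) (s : ℕ) :
    (q : ℤ) * hornerVal q (fun j => christoffelDigit (q - 1) m (s + j)) m -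
      hornerVal q (fun j => christoffelDigit (q - 1) m (s + 1 + j)) m =
      ((q : ℤ) ^ m - 1) * christoffelDigit (q - 1) m s := by
  have h := hornerVal_succ_front q (fun j => christoffelDigit (q - 1) m (s + j)) m
  rw [hornerVal] at h
  simp only [add_zero, christoffelDigit_add_period hm] at h
  simp only [add_assoc, add_comm 1] at h ⊢
  linarith

theorem sub_one_dvd_christoffelValue (hq : 2 ≤ q) (hm : 0 < m) :
    q - 1 ∣ christoffelValue q m := by
  have h := hornerVal_modEq_sum q (christoffelDigit (q - 1) m) m
  rw [hornerVal_christoffelDigit hq hm, sum_christoffelDigit_zero hm,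
    christoffelCount_period hm] at h
  have h2 := h.dvd
  have h1 : ((q - 1 : ℕ) : ℤ) = (q : ℤ) - 1 := by push_cast [Nat.cast_sub (by omega : 1 ≤ q)]; ring
  rw [← h1] at h2
  exact_mod_cast (dvd_sub_right (dvd_refl _)).1 h2

theorem christoffelValue_lt (hq : 2 ≤ q) (hm : 2 ≤ m) : christoffelValue q m < q ^ m - 1 := by
  have h1 : christoffelValue q m ≤ (q - 1) * q ^ (m - 1) := by
    refine (Finset.sum_le_card_nsmul _ _ (q ^ (m - 1)) fun k _ => ?_).trans (by simp)
    exact Nat.pow_le_pow_right (by omega) (Nat.sub_le _ _)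
  have h2 : q ^ m = q * q ^ (m - 1) := by rw [← pow_succ']; congr 1; omega
  have h3 : 2 ≤ q ^ (m - 1) := hq.trans (Nat.le_self_pow (by omega) q)
  rw [Nat.sub_mul, ← h2, one_mul] at h1
  have h4 : q ^ (m - 1) ≤ q ^ m := Nat.pow_le_pow_right (by omega) (by omega)
  omega

theorem isCosetLeader_of_christoffelValue (hq : 2 ≤ q) (hm : 2 ≤ m)
    (hn : (q - 1) * n = q ^ m - 1) {i : ℕ} (hi : (q - 1) * i + christoffelValue q m = q ^ m - 1) :
    IsCosetLeader q n i := by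
  have hm0 : 0 < m := by omega
  have hpos : 0 < christoffelValue q m := by
    have := hornerVal_rotate_christoffelDigit_pos hq hm0 0
    simp only [zero_add] at this
    rw [hornerVal_christoffelDigit hq hm0] at this
    exact_mod_cast this
  have hq1 : 0 < q - 1 := by omega
  have hin : i < n := by
    by_contra! h
    have := Nat.mul_le_mul_left (q - 1) h
    omega
  refine ⟨hin, ⟨0, by simp [Nat.mod_eq_of_lt hin]⟩, ?_⟩
  rintro _ ⟨s, rfl⟩
  set V : ℕ → ℤ := fun s => hornerVal q (fun j => christoffelDigit (q - 1) m (s + j)) m with hV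
  have hqm : ((q : ℤ) ^ m - 1) = (q - 1) * n := by
    have : ((q ^ m - 1 : ℕ) : ℤ) = (((q - 1) * n : ℕ) : ℤ) := by rw [hn]
    push_cast [Nat.cast_sub (Nat.one_le_pow m q (by omega)),
      Nat.cast_sub (by omega : 1 ≤ q)] at this
    exact this
  have hi' : ((q : ℤ) - 1) * i + V 0 = (q - 1) * n := by
    have h0 : V 0 = christoffelValue q m := by
      simp only [hV, zero_add]
      exact hornerVal_christoffelDigit hq hm0
    rw [h0, ← hqm]
    have : (((q - 1) * i + christoffelValue q m : ℕ) : ℤ) = ((q ^ m - 1 : ℕ) : ℤ) := by rw [hi]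
    push_cast [Nat.cast_sub (Nat.one_le_pow m q (by omega)),
      Nat.cast_sub (by omega : 1 ≤ q)] at this
    exact this
  -- `V s / (q - 1)` is congruent to `-i * q ^ s` modulo `n`; together with `0 < V s ≤ V 0` this
  -- determines the residue of `i * q ^ s`.
  have hcong : ∀ s, ∃ t : ℤ, V s = ((q : ℤ) - 1) * (n * t - i * q ^ s) := by
    intro s
    induction s with
    | zero => exact ⟨1, by linear_combination hi'⟩
    | succ s ih =>
      obtain ⟨t, ht⟩ := ih
      have h := hornerVal_rotate_christoffelDigit_step (q := q) hm0 s
      change (q : ℤ) * V s - V (s + 1) = _ at h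
      refine ⟨q * t - christoffelDigit (q - 1) m s, ?_⟩
      rw [hqm] at h
      rw [pow_succ]
      linear_combination q * ht - h
  obtain ⟨t, ht⟩ := hcong s
  have hVpos : 0 < V s := hornerVal_rotate_christoffelDigit_pos hq hm0 s
  have hVle : V s ≤ V 0 := by
    have h := hornerVal_rotate_christoffelDigit_le hq hm0 s
    rw [← hornerVal_christoffelDigit hq hm0] at h
    simpa only [hV, zero_add] using h
  have hqZ : (0 : ℤ) < (q : ℤ) - 1 := by
    have : (2 : ℤ) ≤ q := by exact_mod_cast hq
    linarith
  have h1 : 0 < (n : ℤ) * t - i * q ^ s := pos_of_mul_pos_right (ht ▸ hVpos) hqZ.le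
  have h2 : (n : ℤ) * t - i * q ^ s ≤ n - i := by
    refine le_of_mul_le_mul_left ?_ hqZ
    rw [← ht]
    linarith
  have h3 : ((i * q ^ s : ℕ) : ℤ) % n = n - (n * t - i * q ^ s) := by
    have : ((i * q ^ s : ℕ) : ℤ) = (n - (n * t - i * q ^ s)) + n * (t - 1) := by push_cast; ring
    rw [this, Int.add_mul_emod_self_left, Int.emod_eq_of_lt]
    · have : (0 : ℤ) ≤ i := by positivity
      linarith
    · linarith
  zify
  push_cast at h3
  rw [h3]
  linarith

theorem IsCosetLeader.le_of_christoffelValue (hq : 2 ≤ q) (hm : 2 ≤ m)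
    (hn : (q - 1) * n = q ^ m - 1) {i t : ℕ}
    (hi : (q - 1) * i + christoffelValue q m = q ^ m - 1) (ht : IsCosetLeader q n t) : t ≤ i := by
  by_contra! hit
  have hm0 : 0 < m := by omega
  obtain ⟨htn, -, hmin⟩ := ht
  have hn0 : (0 : ℤ) < n := by exact_mod_cast (by omega : 0 < n)
  have hqm : ((q : ℤ) ^ m - 1) = (q - 1) * n := by
    have : ((q ^ m - 1 : ℕ) : ℤ) = (((q - 1) * n : ℕ) : ℤ) := by rw [hn]
    push_cast [Nat.cast_sub (Nat.one_le_pow m q (by omega)),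
      Nat.cast_sub (by omega : 1 ≤ q)] at this
    exact this
  have hqZ : (0 : ℤ) < (q : ℤ) - 1 := by
    have : (2 : ℤ) ≤ q := by exact_mod_cast hq
    linarith
  -- Complements turn the lower bound by `t` on the coset into an upper bound on every `R j`, which
  -- the cycle lemma will contradict.
  set R : ℕ → ℤ := fun j => n - ((t : ℤ) * q ^ j) % n with hR
  have hRpos : ∀ j, 0 < R j := fun j => by
    have := Int.emod_lt_of_pos ((t : ℤ) * q ^ j) hn0
    simp only [hR]; linarith
  have hRle : ∀ j, R j ≤ n - t := fun j => by
    have : t ≤ t * q ^ j % n := hmin ⟨j, rfl⟩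
    zify at this
    simp only [hR]; linarith
  have hstep : ∀ j, ∃ d, (q : ℤ) * R j - R (j + 1) = n * d := fun j => by
    have h1 := Int.emod_add_mul_ediv ((t : ℤ) * q ^ j) n
    have h2 := Int.emod_add_mul_ediv ((t : ℤ) * q ^ (j + 1)) n
    refine ⟨q - 1 + q * ((t : ℤ) * q ^ j / n) - (t : ℤ) * q ^ (j + 1) / n, ?_⟩
    simp only [hR]
    rw [pow_succ] at h2 ⊢
    linear_combination h2 - q * h1
  choose d hd using hstep
  have hRper : ∀ j, R (j + m) = R j := fun j => by
    simp only [hR]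
    congr 1
    refine Int.ModEq.symm (Int.modEq_iff_dvd.2 ⟨t * q ^ j * (q - 1), ?_⟩)
    rw [pow_add]
    linear_combination (t : ℤ) * q ^ j * hqm
  have hdper : ∀ j, d (j + m) = d j := fun j => by
    have h1 := hd (j + m)
    rw [add_right_comm, hRper, hRper, hd] at h1
    exact (mul_left_cancel₀ hn0.ne' h1).symm
  have hval : ∀ s, ((q : ℤ) - 1) * R s = hornerVal q (fun j => d (s + j)) m := fun s => by
    have h1 := pow_mul_sub_eq_hornerVal hd s m
    rw [hRper] at h1
    refine mul_left_cancel₀ hn0.ne' ?_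
    linear_combination h1 - R s * hqm
  -- Divisibility comes from `q ≡ 1` modulo `q - 1`; positivity from summing the digit relation over
  -- a period, where the shift cancels.
  have hsum : ((q - 1 : ℕ) : ℤ) ≤ ∑ j ∈ Finset.range m, d j := by
    have hdvd : ((q : ℤ) - 1) ∣ ∑ j ∈ Finset.range m, d j := by
      have h1 := hornerVal_modEq_sum q d m
      have h2 := hval 0
      simp only [zero_add] at h2
      rw [← h2] at h1
      exact (dvd_sub_left ⟨R 0, rfl⟩).1 h1.dvd
    have hpos : 0 < ∑ j ∈ Finset.range m, d j := by
      refine pos_of_mul_pos_right (a := (n : ℤ)) ?_ hn0.le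
      have h1 : (n : ℤ) * ∑ j ∈ Finset.range m, d j = (q - 1) * ∑ j ∈ Finset.range m, R j := by
        have h2 : ∑ j ∈ Finset.range m, R (j + 1) = ∑ j ∈ Finset.range m, R j := by
          have h3 := Finset.sum_range_succ R m
          have h4 := Finset.sum_range_succ' R m
          have h5 := hRper 0
          rw [zero_add] at h5
          linarith
        rw [Finset.mul_sum, Finset.sum_congr rfl fun j _ => (hd j).symm,
          Finset.sum_sub_distrib, h2, ← Finset.mul_sum]
        ring
      rw [h1]
      exact mul_pos hqZ (Finset.sum_pos (fun j _ => hRpos j) ⟨0, by simpa using hm0⟩)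
    push_cast [Nat.cast_sub (by omega : 1 ≤ q)]
    exact Int.le_of_dvd hpos hdvd
  obtain ⟨s, hs⟩ := exists_start_partialSum_ge hm0 hdper hsum
  have hdom : hornerVal q (christoffelDigit (q - 1) m) m ≤ hornerVal q (fun j => d (s + j)) m := by
    refine hornerVal_mono (by linarith) fun l hl => ?_
    rw [sum_christoffelDigit_zero hm0]
    have h1 := hs l hl
    have h0 : (0 : ℤ) ≤ ∑ j ∈ Finset.range l, d (s + j) := by
      have hm' : (0 : ℤ) < m := by exact_mod_cast hm0
      exact nonneg_of_mul_nonneg_right (le_trans (by positivity) h1) hm'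
    obtain ⟨P, hP⟩ := Int.eq_ofNat_of_zero_le h0
    rw [hP] at h1 ⊢
    norm_cast at h1 ⊢
    rw [christoffelCount_le_iff hm0, mul_comm]
    exact h1
  rw [hornerVal_christoffelDigit hq hm0, ← hval] at hdom
  have hi' : ((q : ℤ) - 1) * i + christoffelValue q m = (q - 1) * n := by
    rw [← hqm]
    have : (((q - 1) * i + christoffelValue q m : ℕ) : ℤ) = ((q ^ m - 1 : ℕ) : ℤ) := by rw [hi]
    push_cast [Nat.cast_sub (Nat.one_le_pow m q (by omega)),
      Nat.cast_sub (by omega : 1 ≤ q)] at this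
    exact this
  have h5 := hRle s
  have h6 : (i : ℤ) < t := by exact_mod_cast hit
  nlinarith

theorem isGreatest_isCosetLeader (hq : 2 ≤ q) (hm : 2 ≤ m)
    (hn : (q - 1) * n = q ^ m - 1) {i : ℕ} (hi : (q - 1) * i + christoffelValue q m = q ^ m - 1) :
    IsGreatest {i | IsCosetLeader q n i} i :=
  ⟨isCosetLeader_of_christoffelValue hq hm hn hi,
    fun _ ht => ht.le_of_christoffelValue hq hm hn hi⟩

end leader

/-! ### Closed forms of the Christoffel value -/

/-- The power sum `q ^ a + q ^ (2 * a) + ⋯ + q ^ (k * a)`. -/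
def strideSum (R : Type*) [CommSemiring R] (q : R) (a k : ℕ) : R :=
  ∑ l ∈ Finset.range k, q ^ (a * (l + 1))

theorem Nat.cast_strideSum {R : Type*} [CommSemiring R] (q a k : ℕ) :
    ((strideSum ℕ q a k : ℕ) : R) = strideSum R (q : R) a k := by
  simp [strideSum]

theorem strideSum_mul {R : Type*} [CommRing R] (q : R) (a k : ℕ) :
    (q ^ a - 1) * strideSum R q a k = q ^ a * (q ^ (a * k) - 1) := by
  induction k with
  | zero => simp [strideSum]
  | succ k ih =>
    rw [strideSum, Finset.sum_range_succ, mul_add, ← strideSum, ih, mul_add a k 1, pow_add]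
    ring

theorem strideSum_of_pow_eq_one {R : Type*} [CommRing R] {q : R} {a : ℕ} (h : q ^ a = 1) (k : ℕ) :
    strideSum R q a k = k := by
  simp [strideSum, pow_mul, h]

theorem sum_Icc_one_pow (q a k : ℕ) :
    ∑ l ∈ Finset.Icc 1 k, q ^ (a * l) = strideSum ℕ q a k := by
  rw [← Finset.Ico_add_one_right_eq_Icc, Finset.sum_Ico_eq_sum_range, strideSum]
  simp [add_comm]

theorem sum_Icc_pow_add_one (q a s k : ℕ) :
    ∑ l ∈ Finset.Icc (s + 1) k, q ^ (a * l + 1) = q ^ (a * s + 1) * strideSum ℕ q a (k - s) := by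
  rw [← Finset.Ico_add_one_right_eq_Icc, Finset.sum_Ico_eq_sum_range, strideSum, Finset.mul_sum,
    Nat.add_sub_add_right]
  refine Finset.sum_congr rfl fun l _ => ?_
  rw [← pow_add]
  congr 1
  ring

theorem christoffelValue_of_eq_add_one {q m a : ℕ} (hm : m = a * (q - 1) + 1) :
    christoffelValue q m = strideSum ℕ q a (q - 1) := by
  obtain ⟨r, hr⟩ : ∃ r, q - 1 = r := ⟨_, rfl⟩
  rw [christoffelValue, strideSum, hr, ← Finset.sum_range_reflect]
  rw [hr] at hm
  refine Finset.sum_congr rfl fun j hj => ?_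
  rw [Finset.mem_range] at hj
  have h : (r - 1 - j) * m = (r - 1 - j) + r * ((r - 1 - j) * a) := by rw [hm]; ring
  rw [h, Nat.add_mul_div_left _ _ (by omega), Nat.div_eq_of_lt (by omega), zero_add]
  congr 1
  obtain ⟨k, hk⟩ : ∃ k, r = k + (j + 1) := Nat.exists_eq_add_of_le' hj
  have h2 : r - 1 - j = k := by omega
  rw [h2, hm, hk]
  have : a * (k + (j + 1)) = a * (j + 1) + k * a := by ring
  omega

/-- With `r = q - 1` and `k < r`, `⌊k * (a * r + 2) / r⌋` is `k * a`, plus one exactly when `2 * k ≥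
r`. This jump splits the sum at `⌊r / 2⌋`. -/
theorem christoffelValue_of_eq_add_two {q m a : ℕ} (hm : m = a * (q - 1) + 2) :
    christoffelValue q m = strideSum ℕ q a ((q - 1) / 2) +
      q ^ (a * ((q - 1) / 2) + 1) * strideSum ℕ q a (q - 1 - (q - 1) / 2) := by
  obtain ⟨r, hr⟩ : ∃ r, q - 1 = r := ⟨_, rfl⟩
  obtain ⟨A, hA⟩ : ∃ A, r / 2 = A := ⟨_, rfl⟩
  rw [christoffelValue, hr, hA, ← Finset.sum_range_reflect]
  rw [hr] at hm
  have hexp : ∀ j < r, m - 1 - (r - 1 - j) * m / r =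
      if j < A then a * (j + 1) else a * (j + 1) + 1 := by
    intro j hj
    have h : (r - 1 - j) * m = 2 * (r - 1 - j) + r * ((r - 1 - j) * a) := by rw [hm]; ring
    rw [h, Nat.add_mul_div_left _ _ (by omega)]
    obtain ⟨k, hk⟩ : ∃ k, r = k + (j + 1) := Nat.exists_eq_add_of_le' hj
    have h2 : r - 1 - j = k := by omega
    rw [h2]
    have h3 : a * r = a * (j + 1) + k * a := by rw [hk]; ring
    split_ifs with hjA
    · rw [Nat.div_eq_of_lt_le (k := 1) (by omega) (by omega)]
      omega
    · rw [Nat.div_eq_of_lt (by omega)]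
      omega
  rw [Finset.sum_congr rfl fun j hj => by rw [hexp j (Finset.mem_range.1 hj)]]
  obtain ⟨B, hB⟩ : ∃ B, r = A + B := Nat.exists_eq_add_of_le (by omega)
  rw [show r - A = B by omega, hB, Finset.sum_range_add, strideSum, strideSum, Finset.mul_sum]
  congr 1
  · exact Finset.sum_congr rfl fun j hj => by rw [if_pos (Finset.mem_range.1 hj)]
  · refine Finset.sum_congr rfl fun j _ => ?_
    rw [if_neg (by omega), ← pow_add]
    congr 1
    ring

theorem sub_one_mul_div_add_christoffelValue {q m : ℕ} (hq : 2 ≤ q) (hm : 2 ≤ m) :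
    (q - 1) * ((q ^ m - 1 - christoffelValue q m) / (q - 1)) + christoffelValue q m = q ^ m - 1 := by
  have h1 := sub_one_dvd_christoffelValue hq (by omega : 0 < m)
  have h2 : q - 1 ∣ q ^ m - 1 := by simpa using Nat.sub_dvd_pow_sub_pow q 1 m
  rw [Nat.mul_div_cancel' (Nat.dvd_sub h2 h1), Nat.sub_add_cancel (christoffelValue_lt hq hm).le]

theorem deltaZero_spec {q m a : ℕ} (hq : 3 < q) (ha : 1 ≤ a) (hm : m = a * (q - 1) + 1) :
    (q - 1) * deltaZero q m a + christoffelValue q m = q ^ m - 1 := by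
  have hm2 : 2 ≤ m := by
    have : 0 < a * (q - 1) := Nat.mul_pos ha (by omega)
    omega
  -- The separate term `q ^ (m - 1)` is the missing summand `l = q - 1`.
  have h : q ^ (m - 1) + ∑ l ∈ Finset.Icc 1 (q - 2), q ^ (a * l) = christoffelValue q m := by
    rw [christoffelValue_of_eq_add_one hm, ← sum_Icc_one_pow, show q - 1 = q - 2 + 1 by omega,
      Finset.sum_Icc_succ_top (by omega), add_comm, hm, Nat.add_sub_cancel,
      show q - 2 + 1 = q - 1 by omega]
  rw [deltaZero, Nat.sub_sub _ (q ^ (m - 1)), h]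
  exact sub_one_mul_div_add_christoffelValue (by omega) hm2

theorem deltaOne_spec {q m a : ℕ} (hq : 3 < q) (hm : m = a * (q - 1) + 2) :
    (q - 1) * deltaOne q m a + christoffelValue q m = q ^ m - 1 := by
  have h : q ^ (m - 1) + ∑ l ∈ Finset.Icc 1 ((q - 1) / 2), q ^ (a * l) +
      ∑ l ∈ Finset.Icc ((q - 1) / 2 + 1) (q - 2), q ^ (a * l + 1) = christoffelValue q m := by
    rw [christoffelValue_of_eq_add_two hm, ← sum_Icc_one_pow, ← sum_Icc_pow_add_one,
      show q - 1 = q - 2 + 1 by omega, Finset.sum_Icc_succ_top (b := q - 2) (by omega), hm,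
      show q - 2 + 1 = q - 1 by omega,
      show a * (q - 1) + 2 - 1 = a * (q - 1) + 1 by omega]
    ring
  rw [deltaOne, Nat.sub_sub _ (q ^ (m - 1)), Nat.sub_sub, h]
  exact sub_one_mul_div_add_christoffelValue (by omega) (by omega)

/-! ### Coprimality with the geometric sum -/

theorem coprime_strideSum_geomSum (q a : ℕ) {A : ℕ} :
    (strideSum ℕ q a A).Coprime (∑ i ∈ Finset.range (a * A + 1), q ^ i) := by
  refine Nat.coprime_of_dvd fun p hp h1 h2 => ?_
  have := Fact.mk hp
  rw [← ZMod.natCast_eq_zero_iff] at h1 h2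
  rw [Nat.cast_strideSum] at h1
  push_cast at h2
  set Q : ZMod p := (q : ZMod p)
  have h3 := geom_sum_mul Q (a * A + 1)
  rw [h2, zero_mul] at h3
  have h4 := strideSum_mul Q a A
  rw [h1, mul_zero] at h4
  have hQ : Q ≠ 0 := by
    rintro hQ
    simp [hQ] at h3
  have h5 : Q ^ (a * A) = 1 := by
    rcases mul_eq_zero.1 h4.symm with h | h
    · exact absurd h (pow_ne_zero _ hQ)
    · exact sub_eq_zero.1 h
  have h6 : Q = 1 := by
    rw [pow_succ, h5, one_mul] at h3
    exact sub_eq_zero.1 h3.symm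
  rw [h6, strideSum_of_pow_eq_one (one_pow a)] at h1
  simp [h6, h1] at h2

/-- Modulo a common prime divisor put `Y = Q ^ (a * A + 1)`. The geometric sum gives `Q ^ a * Y ^ 2
= 1`, and telescoping then gives `(Q - 1) * Q ^ a * (Y + 1) = 0`. If `Q = 1`, then `2 * A + 1` and
`a * (2 * A + 1) + 2` both vanish, which is impossible. If `Y = -1`, then `Q ^ a = 1` and the first
sum is `A - (A + 1) = -1`. -/
theorem coprime_strideSum_add_geomSum (q a A : ℕ) :
    (strideSum ℕ q a A + q ^ (a * A + 1) * strideSum ℕ q a (A + 1)).Coprime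
      (∑ i ∈ Finset.range (a * (2 * A + 1) + 2), q ^ i) := by
  refine Nat.coprime_of_dvd fun p hp h1 h2 => ?_
  have := Fact.mk hp
  rw [← ZMod.natCast_eq_zero_iff] at h1 h2
  push_cast [Nat.cast_strideSum] at h1 h2
  set Q : ZMod p := (q : ZMod p)
  have h3 := geom_sum_mul Q (a * (2 * A + 1) + 2)
  rw [h2, zero_mul] at h3
  have h3 : Q ^ a * (Q ^ (a * A) * Q) ^ 2 = 1 := by
    rw [← sub_eq_zero, h3]
    ring
  have h4 : (Q - 1) * (Q ^ a * (Q ^ (a * A) * Q + 1)) = 0 := by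
    have e1 := strideSum_mul Q a A
    have e2 := strideSum_mul Q a (A + 1)
    have e3 : Q ^ (a * (A + 1)) = Q ^ (a * A) * Q ^ a := by ring
    rw [e3] at e2
    rw [pow_succ] at h1
    linear_combination (-(Q * (Q ^ a - 1))) * h1 + Q * e1 + (Q ^ (a * A) * Q * Q) * e2 +
      Q ^ a * h3
  have hX : Q ^ a ≠ 0 := by
    intro h
    simp [h] at h3
  rcases mul_eq_zero.1 h4 with h | h
  · have hQ : Q = 1 := sub_eq_zero.1 h
    simp only [hQ, strideSum_of_pow_eq_one (one_pow a), one_pow, one_mul, Finset.sum_const,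
      Finset.card_range, nsmul_eq_mul, mul_one] at h1 h2
    push_cast at h1 h2
    exact one_ne_zero (α := ZMod p) (by linear_combination (1 + a * (A : ZMod p)) * h1 - A * h2)
  · have hYQ : Q ^ (a * A) * Q = -1 :=
      eq_neg_of_add_eq_zero_left ((mul_eq_zero.1 h).resolve_left hX)
    have hX1 : Q ^ a = 1 := by simpa [hYQ] using h3
    rw [strideSum_of_pow_eq_one hX1, strideSum_of_pow_eq_one hX1, pow_succ, hYQ] at h1
    push_cast at h1
    exact one_ne_zero (α := ZMod p) (by linear_combination -h1)

/-! ### Subfields generated by a power of a primitive root -/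

section finiteField

variable {F : Type*} [Field F] [Fintype F] {K : Type*} [Field K] [Algebra F K]

theorem FiniteField.exists_pow_of_algEquiv [FiniteDimensional F K] (σ : K ≃ₐ[F] K) :
    ∃ s : ℕ, ∀ x, σ x = x ^ Fintype.card F ^ s := by
  have := Module.finite_of_finite F (M := K)
  obtain ⟨s, hs⟩ := (FiniteField.bijective_frobeniusAlgEquivOfAlgebraic_pow F K).2 σ
  refine ⟨s, fun x => ?_⟩
  rw [← hs]
  dsimp only
  rw [AlgEquiv.coe_pow, FiniteField.coe_frobeniusAlgEquivOfAlgebraic_iterate]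

theorem FiniteField.exists_algebraMap_eq_of_pow_card [FiniteDimensional F K] {x : K}
    (hx : x ^ Fintype.card F = x) :
    ∃ c : F, algebraMap F K c = x := by
  have := Module.finite_of_finite F (M := K)
  refine IntermediateField.mem_bot.1 ((IsGalois.mem_bot_iff_fixed x).2 fun σ => ?_)
  obtain ⟨s, hs⟩ := FiniteField.exists_pow_of_algEquiv σ
  rw [hs]
  clear hs
  induction s with
  | zero => simp
  | succ s ih => rw [pow_succ, pow_mul, ih, hx]

theorem FiniteField.aeval_pow_card_pow (p : F[X]) (x : K) (s : ℕ) :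
    aeval (x ^ Fintype.card F ^ s) p = aeval x p ^ Fintype.card F ^ s := by
  have h (y : K) : ((FiniteField.frobeniusAlgHom F K) ^ s) y = y ^ Fintype.card F ^ s := by
    rw [AlgHom.coe_pow, FiniteField.coe_frobeniusAlgHom, pow_iterate]
  rw [← h, ← h, aeval_algHom_apply]

variable {q h e N : ℕ} {β : K}

theorem pow_card_pow_eq_self_of_mem_adjoin [FiniteDimensional F K] {η z : K}
    (hη : η ^ Fintype.card F ^ h = η) (hz : z ∈ F⟮η⟯) : z ^ Fintype.card F ^ h = z := by
  rw [← IntermediateField.mem_toSubalgebra,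
    IntermediateField.adjoin_simple_toSubalgebra_of_isAlgebraic (Algebra.IsAlgebraic.isAlgebraic η),
    Algebra.adjoin_singleton_eq_range_aeval] at hz
  obtain ⟨p, rfl⟩ := hz
  change aeval η p ^ Fintype.card F ^ h = aeval η p
  rw [← FiniteField.aeval_pow_card_pow, hη]

theorem IsPrimitiveRoot.pow_pow_eq_self (hq : 0 < q)
    (hβ : IsPrimitiveRoot β (q ^ h - 1)) (e : ℕ) : (β ^ e) ^ q ^ h = β ^ e := by
  have h1 : 0 < q ^ h := pow_pos hq h
  rw [← pow_mul, mul_comm, pow_mul, ← Nat.sub_add_cancel h1, pow_succ, hβ.pow_eq_one, one_mul]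

/-- If `e` is coprime to `(q ^ h - 1) / (q - 1)`, then the scalars together with `β ^ e`
generate every power of `β`. -/
theorem exists_eq_algebraMap_mul_pow [FiniteDimensional F K] (hq : Fintype.card F = q)
    (hN : (q - 1) * N = q ^ h - 1)
    (hN1 : 1 < N) (hβ : IsPrimitiveRoot β (q ^ h - 1)) (he : e.Coprime N) :
    ∃ c : F, c ≠ 0 ∧ ∃ i : ℕ, β = algebraMap F K c * (β ^ e) ^ i := by
  obtain ⟨i, -, hi⟩ := Nat.exists_mul_mod_eq_one_of_coprime he hN1
  obtain ⟨t, ht⟩ : ∃ t, e * i = 1 + N * t := ⟨e * i / N, by rw [← hi, Nat.mod_add_div]⟩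
  have hq2 : 1 < q := hq ▸ Fintype.one_lt_card
  have hβ0 : β ≠ 0 := hβ.ne_zero (by rw [← hN]; exact (Nat.mul_pos (by omega) (by omega)).ne')
  -- Since `β ^ (e * i) = β * β ^ (N * t)`, the correcting factor has order dividing `q - 1`, so it
  -- is a scalar.
  have hγ : (β ^ (N * t))⁻¹ ^ (q - 1) = 1 := by
    rw [inv_pow, ← pow_mul, mul_comm, ← mul_assoc, hN, pow_mul, hβ.pow_eq_one, one_pow, inv_one]
  obtain ⟨c, hc⟩ := FiniteField.exists_algebraMap_eq_of_pow_card (F := F)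
    (x := (β ^ (N * t))⁻¹) (by rw [hq, ← Nat.sub_add_cancel hq2.le, pow_succ, hγ, one_mul])
  refine ⟨c, ?_, i, ?_⟩
  · rintro rfl
    rw [map_zero] at hc
    exact inv_ne_zero (pow_ne_zero _ hβ0) hc.symm
  · rw [hc, ← pow_mul, ht, pow_add, pow_one, mul_left_comm, inv_mul_cancel₀ (pow_ne_zero _ hβ0),
      mul_one]

theorem exists_eq_algebraMap_mul_pow_of_mem_adjoin [FiniteDimensional F K] (hq : Fintype.card F = q)
    (hN : (q - 1) * N = q ^ h - 1) (hN1 : 1 < N) (hβ : IsPrimitiveRoot β (q ^ h - 1))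
    (he : e.Coprime N) {z : K} (hz : z ∈ F⟮β ^ e⟯) (hz0 : z ≠ 0) :
    ∃ c : F, c ≠ 0 ∧ ∃ i : ℕ, z = algebraMap F K c * (β ^ e) ^ i := by
  have hq2 : 1 < q := hq ▸ Fintype.one_lt_card
  have h1 : 0 < q ^ h := pow_pos (by omega) h
  have hpos : 0 < q ^ h - 1 := by rw [← hN]; exact Nat.mul_pos (by omega) (by omega)
  have := NeZero.of_pos hpos
  have hz1 : z ^ (q ^ h - 1) = 1 := by
    have h2 := pow_card_pow_eq_self_of_mem_adjoin (h := h) (hq ▸ hβ.pow_pow_eq_self (by omega) e) hz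
    rw [hq, ← Nat.sub_add_cancel h1, pow_succ] at h2
    exact mul_right_cancel₀ hz0 (h2.trans (one_mul z).symm)
  obtain ⟨t, -, rfl⟩ := hβ.eq_pow_of_pow_eq_one hz1
  obtain ⟨c, hc, i, hi⟩ := exists_eq_algebraMap_mul_pow hq hN hN1 hβ he
  refine ⟨c ^ t, pow_ne_zero _ hc, i * t, ?_⟩
  conv_lhs => rw [hi]
  rw [mul_pow, map_pow, ← pow_mul (β ^ e)]

theorem finrank_adjoin_pow [FiniteDimensional F K] (hq : Fintype.card F = q)
    (hN : (q - 1) * N = q ^ h - 1) (hN1 : 1 < N) (hβ : IsPrimitiveRoot β (q ^ h - 1))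
    (he : e.Coprime N) : Module.finrank F F⟮β ^ e⟯ = h := by
  have hq2 : 1 < q := hq ▸ Fintype.one_lt_card
  have hpos : 0 < q ^ h - 1 := by rw [← hN]; exact Nat.mul_pos (by omega) (by omega)
  have := NeZero.of_pos hpos
  have : Finite K := Module.finite_of_finite F
  have : Fintype F⟮β ^ e⟯ := Fintype.ofFinite _
  set k := Module.finrank F F⟮β ^ e⟯
  have hcard : Fintype.card F⟮β ^ e⟯ = q ^ k := by rw [Module.card_eq_pow_finrank (K := F), hq]
  have hβmem : β ∈ F⟮β ^ e⟯ := by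
    obtain ⟨c, -, i, hi⟩ := exists_eq_algebraMap_mul_pow hq hN hN1 hβ he
    have : algebraMap F K c * (β ^ e) ^ i ∈ F⟮β ^ e⟯ :=
      mul_mem (IntermediateField.algebraMap_mem _ _)
        (pow_mem (IntermediateField.mem_adjoin_simple_self F _) _)
    rwa [← hi] at this
  have hk : 0 < q ^ k - 1 := by
    have : 1 < q ^ k := Nat.one_lt_pow (Module.finrank_pos (R := F) (M := F⟮β ^ e⟯)).ne' hq2
    omega
  -- The order of `β` gives one divisibility. The other holds because a generator of the unit group
  -- of the subfield is fixed by the `q ^ h`-power map.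
  have h1 : q ^ h - 1 ∣ q ^ k - 1 := by
    refine hβ.dvd_of_pow_eq_one _ ?_
    have h2 := FiniteField.pow_card_sub_one_eq_one (⟨β, hβmem⟩ : F⟮β ^ e⟯) (by
      rw [Ne, Subtype.ext_iff]
      exact hβ.ne_zero hpos.ne')
    rw [hcard] at h2
    simpa using congrArg Subtype.val h2
  have h2 : q ^ k - 1 ∣ q ^ h - 1 := by
    obtain ⟨g, hg⟩ := IsCyclic.exists_ofOrder_eq_natCard (α := F⟮β ^ e⟯ˣ)
    rw [Nat.card_units, Nat.card_eq_fintype_card, hcard] at hg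
    rw [← hg]
    refine orderOf_dvd_of_pow_eq_one (Units.ext (Subtype.ext ?_))
    have h3 := pow_card_pow_eq_self_of_mem_adjoin (h := h)
      (hq ▸ hβ.pow_pow_eq_self (by omega) e) g.1.2
    rw [hq, ← Nat.sub_add_cancel (by omega : 1 ≤ q ^ h), pow_succ] at h3
    have hg0 : ((g : F⟮β ^ e⟯) : K) ≠ 0 := by simp
    simpa using mul_right_cancel₀ hg0 (h3.trans (one_mul _).symm)
  have h3 := Nat.dvd_antisymm h1 h2
  exact (Nat.pow_right_injective hq2 (by dsimp only; omega)).symm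

end finiteField

/-! ### One-weight cyclic codes -/

section code

variable {F : Type*} [Field F] {K : Type*} [Field K] [Algebra F K] {n : ℕ}

theorem aeval_wordPoly (c : Fin n → F) (x : K) :
    aeval x (wordPoly c) = ∑ i, algebraMap F K (c i) * x ^ (i : ℕ) := by
  simp [wordPoly]

theorem wordPoly_add (c d : Fin n → F) : wordPoly (c + d) = wordPoly c + wordPoly d := by
  simp [wordPoly, add_mul, Finset.sum_add_distrib]

theorem wordPoly_smul (a : F) (c : Fin n → F) : wordPoly (a • c) = C a * wordPoly c := by
  simp [wordPoly, Finset.mul_sum, mul_assoc]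

theorem coeff_wordPoly (c : Fin n → F) (i : Fin n) : (wordPoly c).coeff i = c i := by
  simp [wordPoly, coeff_C_mul, coeff_X_pow, Fin.val_inj]

theorem degree_wordPoly_lt (c : Fin n → F) : (wordPoly c).degree < n := by
  refine (degree_sum_le _ _).trans_lt ((Finset.sup_lt_iff (WithBot.bot_lt_coe n)).2 fun i _ => ?_)
  exact (degree_C_mul_X_pow_le _ _).trans_lt (Nat.cast_lt.2 i.2)

theorem wordPoly_coeff {p : F[X]} (hp : p.natDegree < n) :
    wordPoly (fun i : Fin n => p.coeff i) = p := by
  rw [wordPoly, Fin.sum_univ_eq_sum_range (fun i => C (p.coeff i) * X ^ i) n]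
  exact (p.as_sum_range_C_mul_X_pow' hp).symm

theorem eq_zero_of_aeval_wordPoly {θ : K} (hθ : IsPrimitiveRoot θ n) {c : Fin n → F}
    (h : ∀ t < n, aeval (θ ^ t) (wordPoly c) = 0) : c = 0 := by
  rcases Nat.eq_zero_or_pos n with rfl | hn
  · exact Subsingleton.elim _ _
  have h0 : (wordPoly c).map (algebraMap F K) = 0 := by
    refine eq_zero_of_natDegree_lt_card_of_eval_eq_zero _ (f := fun t : Fin n => θ ^ (t : ℕ))
      (fun s t hst => Fin.ext (hθ.pow_inj s.2 t.2 hst)) (fun t => ?_) ?_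
    · rw [eval_map_algebraMap]
      exact h t t.2
    · rw [natDegree_map, Fintype.card_fin]
      by_cases hw : wordPoly c = 0
      · simpa [hw] using hn
      · exact (natDegree_lt_iff_degree_lt hw).2 (degree_wordPoly_lt c)
  rw [Polynomial.map_eq_zero] at h0
  ext i
  rw [← coeff_wordPoly c, h0]
  simp

theorem pow_mul_aeval_wordPoly_rotate [NeZero n] {x : K} (hx : x ^ n = 1) (c : Fin n → F)
    (t : Fin n) :
    x ^ (t : ℕ) * aeval x (wordPoly fun i => c (i + t)) = aeval x (wordPoly c) := by
  rw [aeval_wordPoly, aeval_wordPoly, Finset.mul_sum,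
    ← Equiv.sum_comp (Equiv.addRight t) fun i => algebraMap F K (c i) * x ^ (i : ℕ)]
  refine Finset.sum_congr rfl fun i _ => ?_
  rw [Equiv.coe_addRight, Fin.val_add, ← pow_eq_pow_mod _ hx, pow_add]
  ring

theorem hammingNorm_rotate [DecidableEq F] [NeZero n] (c : Fin n → F) (t : Fin n) :
    hammingNorm (fun i => c (i + t)) = hammingNorm c :=
  Finset.card_equiv (Equiv.addRight t) fun i => by simp

/-- Double counting of the weights of a code in which all nonzero words have weight `w`. -/
theorem weight_mul_of_oneWeight [Fintype F] [DecidableEq F] {C : Submodule F (Fin n → F)} {w : ℕ}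
    (hw : ∀ c ∈ C, c ≠ 0 → hammingNorm c = w) (hC : ∀ i, ∃ c ∈ C, c i ≠ 0) :
    w * (Fintype.card F ^ Module.finrank F C - 1) =
      n * (Fintype.card F ^ Module.finrank F C - Fintype.card F ^ (Module.finrank F C - 1)) := by
  classical
  have : Fintype C := Fintype.ofFinite C
  have hcard : Fintype.card C = Fintype.card F ^ Module.finrank F C :=
    Module.card_eq_pow_finrank (K := F)
  have h1 : ∑ c : C, hammingNorm (c : Fin n → F) =
      w * (Fintype.card F ^ Module.finrank F C - 1) := by
    rw [← Finset.add_sum_erase _ _ (Finset.mem_univ 0), Finset.sum_congr rfl (g := fun _ => w)]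
    · simp [Finset.card_erase_of_mem, hcard, mul_comm]
    · intro c hc
      exact hw c c.2 fun h => Finset.ne_of_mem_erase hc (Subtype.ext h)
  have h2 : ∑ c : C, hammingNorm (c : Fin n → F) =
      ∑ i : Fin n, Fintype.card {c : C // (c : Fin n → F) i ≠ 0} := by
    simp only [hammingNorm, Finset.card_filter, Fintype.card_subtype]
    exact Finset.sum_comm
  rw [← h1, h2, Finset.sum_congr rfl (g := fun _ => Fintype.card F ^ Module.finrank F C -
    Fintype.card F ^ (Module.finrank F C - 1))]
  · simp
  intro i _
  obtain ⟨c, hcC, hci⟩ := hC i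
  -- Each coordinate is a nonzero functional on `C`, so its kernel has codimension one.
  let f : C →ₗ[F] F := (LinearMap.proj i).comp C.subtype
  have hf : LinearMap.range f = ⊤ := by
    refine LinearMap.range_eq_top.2 (LinearMap.surjective fun h => hci ?_)
    exact LinearMap.congr_fun h ⟨c, hcC⟩
  have hker : Module.finrank F (LinearMap.ker f) = Module.finrank F C - 1 := by
    have := f.finrank_range_add_finrank_ker
    rw [hf, finrank_top, Module.finrank_self] at this
    omega
  have hk : Fintype.card {c : C // (c : Fin n → F) i = 0} =
      Fintype.card F ^ (Module.finrank F C - 1) := by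
    have := Fintype.ofFinite (LinearMap.ker f)
    rw [← hker, ← Module.card_eq_pow_finrank (K := F) (V := LinearMap.ker f)]
    exact Fintype.card_congr (Equiv.subtypeEquivRight fun c => by simp [f])
  rw [Fintype.card_subtype_compl, hcard, hk]

/-- A nonzero code of length `n` stable under rotation, on which evaluation at an `n`-th root of
unity `ζ` is injective, has constant weight if the scalars and `ζ⁻¹` generate `F(ζ)ˣ`. -/
theorem oneWeight_of_rotate [Fintype F] [DecidableEq F] [NeZero n] {C : Submodule F (Fin n → F)}
    {ζ : K} (hζ : ζ ^ n = 1) (L : IntermediateField F K) (hL : ζ ∈ L)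
    (hrot : ∀ c ∈ C, ∀ t : Fin n, (fun i => c (i + t)) ∈ C) (hne : ∃ c ∈ C, c ≠ 0)
    (hinj : ∀ c ∈ C, aeval ζ (wordPoly c) = 0 → c = 0)
    (hgen : ∀ z ∈ L, z ≠ 0 → ∃ a : F, a ≠ 0 ∧ ∃ i : ℕ, z = algebraMap F K a * ζ⁻¹ ^ i) :
    Module.finrank F C = Module.finrank F L ∧
      ∃ w, (∀ c ∈ C, c ≠ 0 → hammingNorm c = w) ∧
        w * (Fintype.card F ^ Module.finrank F L - 1) = n * (Fintype.card F ^ Module.finrank F L -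
          Fintype.card F ^ (Module.finrank F L - 1)) := by
  have hζ0 : ζ ≠ 0 := by
    rintro rfl
    simp [zero_pow (NeZero.ne n)] at hζ
  have hmem : ∀ c : Fin n → F, aeval ζ (wordPoly c) ∈ L := fun c => by
    rw [aeval_wordPoly]
    exact sum_mem fun i _ => mul_mem (L.algebraMap_mem _) (pow_mem hL _)
  obtain ⟨c₀, hc₀, hc₀0⟩ := hne
  have hev0 : aeval ζ (wordPoly c₀) ≠ 0 := fun h => hc₀0 (hinj _ hc₀ h)
  -- Scaled rotations of the single word `c₀` already realise every nonzero element of `L` as an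
  -- evaluation.
  have key : ∀ z ∈ L, z ≠ 0 → ∃ a : F, a ≠ 0 ∧ ∃ t : Fin n,
      aeval ζ (wordPoly (a • fun i => c₀ (i + t))) = z := by
    intro z hz hz0
    obtain ⟨a, ha, i, hi⟩ := hgen (z / aeval ζ (wordPoly c₀)) (div_mem hz (hmem c₀))
      (div_ne_zero hz0 hev0)
    refine ⟨a, ha, Fin.ofNat n i, ?_⟩
    have h1 := pow_mul_aeval_wordPoly_rotate hζ c₀ (Fin.ofNat n i)
    rw [Fin.val_ofNat, ← pow_eq_pow_mod _ hζ] at h1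
    rw [div_eq_iff hev0, ← h1] at hi
    rw [wordPoly_smul, map_mul, aeval_C, hi, mul_assoc, ← mul_assoc (ζ⁻¹ ^ i), ← mul_pow,
      inv_mul_cancel₀ hζ0, one_pow, one_mul]
  have hw : ∀ c ∈ C, c ≠ 0 → hammingNorm c = hammingNorm c₀ := by
    intro c hc hc0
    obtain ⟨a, ha, t, hat⟩ := key _ (hmem c) fun h => hc0 (hinj c hc h)
    have h1 : c = a • fun i => c₀ (i + t) := by
      refine sub_eq_zero.1 (hinj _ (sub_mem hc (C.smul_mem a (hrot c₀ hc₀ t))) ?_)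
      rw [sub_eq_add_neg, ← neg_one_smul F, wordPoly_add, wordPoly_smul (-1), map_add, map_mul, hat]
      simp
    rw [h1, hammingNorm_smul fun _ => IsSMulRegular.of_ne_zero ha, hammingNorm_rotate]
  let e : C →ₗ[F] L :=
    { toFun := fun c => ⟨aeval ζ (wordPoly (c : Fin n → F)), hmem c⟩
      map_add' := fun c d => Subtype.ext (by simp [wordPoly_add])
      map_smul' := fun a c => Subtype.ext (by
        change aeval ζ (wordPoly (a • (c : Fin n → F))) = a • aeval ζ (wordPoly (c : Fin n → F))
        rw [wordPoly_smul, map_mul, aeval_C, Algebra.smul_def]) }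
  have he : Function.Bijective e := by
    refine ⟨(injective_iff_map_eq_zero e).2 fun c hc => Subtype.ext
      (hinj c c.2 (congrArg Subtype.val hc)), fun z => ?_⟩
    by_cases hz : z = 0
    · exact ⟨0, by rw [hz, map_zero]⟩
    · obtain ⟨a, ha, t, hat⟩ := key z z.2 fun h => hz (Subtype.ext h)
      exact ⟨⟨_, C.smul_mem a (hrot c₀ hc₀ t)⟩, Subtype.ext hat⟩
  have hrank := (LinearEquiv.ofBijective e he).finrank_eq
  refine ⟨hrank, hammingNorm c₀, hw, ?_⟩
  rw [← hrank]
  refine weight_mul_of_oneWeight hw fun i => ?_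
  obtain ⟨j, hj⟩ := Function.ne_iff.1 hc₀0
  exact ⟨_, hrot c₀ hc₀ (j - i), by simpa using hj⟩

theorem mem_codeOfGenerator_bchGenerator {θ : K} {δ : ℕ} {c : Fin n → F} :
    c ∈ codeOfGenerator n (bchGenerator F θ (δ + 1) 0) ↔
      ∀ j < δ, aeval (θ ^ j) (wordPoly c) = 0 := by
  change bchGenerator F θ (δ + 1) 0 ∣ wordPoly c ↔ _
  unfold bchGenerator
  simp only [Finset.lcm_dvd_iff, Nat.add_sub_cancel, Finset.mem_range, zero_add]
  exact forall₂_congr fun j _ => minpoly.dvd_iff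

theorem exists_isCosetLeader_eq {q : ℕ} (hn : 0 < n) (t : ℕ) :
    ∃ j, IsCosetLeader q n (t * q ^ j % n) := by
  classical
  have hne : ∃ l, ∃ j, l = t * q ^ j % n := ⟨_, 0, rfl⟩
  obtain ⟨j, hj⟩ := Nat.find_spec hne
  refine ⟨j, Nat.mod_lt _ hn, ⟨0, by simp⟩, ?_⟩
  rintro _ ⟨s, rfl⟩
  rw [← hj]
  refine Nat.find_min' hne ⟨j + s, ?_⟩
  rw [hj, pow_add, ← mul_assoc, Nat.mod_mul_mod]

/-- The narrow-sense-with-zero BCH code whose designed distance is the largest coset leader. -/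
theorem bchCode_greatest_isCosetLeader [Fintype F] [DecidableEq F] [FiniteDimensional F K]
    [NeZero n] {q δ : ℕ} (hq : Fintype.card F = q) {θ : K} (hθ : IsPrimitiveRoot θ n)
    (hδ : IsGreatest {i | IsCosetLeader q n i} δ)
    (hgen : ∀ z ∈ F⟮(θ ^ δ)⁻¹⟯, z ≠ 0 →
      ∃ a : F, a ≠ 0 ∧ ∃ i : ℕ, z = algebraMap F K a * (θ ^ δ)⁻¹ ^ i) :
    Module.finrank F (codeOfGenerator n (bchGenerator F θ (δ + 1) 0)) =
        Module.finrank F F⟮(θ ^ δ)⁻¹⟯ ∧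
      (∃ c ∈ codeOfGenerator n (bchGenerator F θ (δ + 1) 0), c ≠ 0) ∧
      ∃ w, (∀ c ∈ codeOfGenerator n (bchGenerator F θ (δ + 1) 0), c ≠ 0 → hammingNorm c = w) ∧
        w * (q ^ Module.finrank F F⟮(θ ^ δ)⁻¹⟯ - 1) = n * (q ^ Module.finrank F F⟮(θ ^ δ)⁻¹⟯ -
          q ^ (Module.finrank F F⟮(θ ^ δ)⁻¹⟯ - 1)) := by
  have hn : 0 < n := NeZero.pos n
  have hint : ∀ j, IsIntegral F (θ ^ j) := fun j => Algebra.IsIntegral.isIntegral _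
  have hroot : ∀ j, (θ ^ j) ^ n = 1 := fun j => by
    rw [← pow_mul, mul_comm, pow_mul, hθ.pow_eq_one, one_pow]
  have hθ0 : θ ≠ 0 := hθ.ne_zero hn.ne'
  -- Conjugates of `θ ^ δ` are the `θ ^ (δ * q ^ s)`, and `δ` is least in its coset.
  have hnonroot : ∀ j < δ, aeval (θ ^ j) (minpoly F (θ ^ δ)) ≠ 0 := by
    intro j hj h0
    have : Finite K := Module.finite_of_finite F
    obtain ⟨σ, hσ⟩ := (isConjRoot_of_aeval_eq_zero (hint δ) h0).symm.exists_algEquiv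
    obtain ⟨s, hs⟩ := FiniteField.exists_pow_of_algEquiv σ
    rw [hs, hq, ← pow_mul, pow_eq_pow_mod (δ * q ^ s) hθ.pow_eq_one] at hσ
    have h1 : j = δ * q ^ s % n :=
      (hθ.pow_inj (Nat.mod_lt _ hn) (hj.trans hδ.1.1) hσ).symm
    exact absurd (hδ.1.2.2 ⟨s, h1⟩) (not_le.2 hj)
  have hne : ∃ c ∈ codeOfGenerator n (bchGenerator F θ (δ + 1) 0), c ≠ 0 := by
    -- The nonzero codeword is the cofactor of this minimal polynomial in `X ^ n - 1`.
    obtain ⟨p, hp⟩ : minpoly F (θ ^ δ) ∣ X ^ n - 1 :=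
      minpoly.dvd F _ (by simp [hroot])
    have hX : (X ^ n - 1 : F[X]) ≠ 0 := (monic_X_pow_sub_C 1 hn.ne').ne_zero
    have hp0 : p ≠ 0 := by
      rintro rfl
      exact hX (by rw [hp, mul_zero])
    have hdeg : p.natDegree < n := by
      have h1 := natDegree_mul (minpoly.ne_zero (hint δ)) hp0
      have h2 : (X ^ n - 1 : F[X]).natDegree = n := natDegree_X_pow_sub_C (r := 1)
      rw [← hp, h2] at h1
      have := minpoly.natDegree_pos (hint δ)
      omega
    refine ⟨fun i => p.coeff i, mem_codeOfGenerator_bchGenerator.2 fun j hj => ?_,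
      fun h => hp0 ?_⟩
    · rw [wordPoly_coeff hdeg]
      have h1 := congrArg (aeval (θ ^ j)) hp
      rw [map_mul, map_sub, map_pow, aeval_X, map_one, hroot, sub_self] at h1
      exact (mul_eq_zero.1 h1.symm).resolve_left (hnonroot j hj)
    · rw [← wordPoly_coeff hdeg, h]
      simp [wordPoly]
  -- Every exponent is conjugate to a leader, which is either below `δ` or equal to it; so all `n`
  -- roots of unity are zeros of the word.
  have hinj : ∀ c ∈ codeOfGenerator n (bchGenerator F θ (δ + 1) 0),
      aeval (θ ^ δ) (wordPoly c) = 0 → c = 0 := by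
    intro c hc h0
    rw [mem_codeOfGenerator_bchGenerator] at hc
    refine eq_zero_of_aeval_wordPoly hθ fun t _ => ?_
    obtain ⟨j, hj⟩ := exists_isCosetLeader_eq (q := q) hn t
    have h1 : aeval (θ ^ (t * q ^ j % n)) (wordPoly c) = 0 := by
      rcases (hδ.2 hj).lt_or_eq with h | h
      · exact hc _ h
      · rw [h, h0]
    rw [← pow_eq_pow_mod _ hθ.pow_eq_one, pow_mul, ← hq, FiniteField.aeval_pow_card_pow] at h1
    exact eq_zero_of_pow_eq_zero h1
  have hrot : ∀ c ∈ codeOfGenerator n (bchGenerator F θ (δ + 1) 0), ∀ t : Fin n,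
      (fun i => c (i + t)) ∈ codeOfGenerator n (bchGenerator F θ (δ + 1) 0) := by
    intro c hc t
    rw [mem_codeOfGenerator_bchGenerator] at hc ⊢
    intro j hj
    have h1 := pow_mul_aeval_wordPoly_rotate (hroot j) c t
    rw [hc j hj] at h1
    exact (mul_eq_zero.1 h1).resolve_left (pow_ne_zero _ (pow_ne_zero _ hθ0))
  have hmem : θ ^ δ ∈ F⟮(θ ^ δ)⁻¹⟯ := by
    have := inv_mem (IntermediateField.mem_adjoin_simple_self F (θ ^ δ)⁻¹)
    rwa [inv_inv] at this
  have hmain := oneWeight_of_rotate (hroot δ) F⟮(θ ^ δ)⁻¹⟯ hmem hrot hne hinj hgen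
  rw [hq] at hmain
  exact ⟨hmain.1, hne, hmain.2⟩

theorem isOneWeight_and_hasParameters [DecidableEq F] {C : Submodule F (Fin n → F)} {k w : ℕ}
    (hk : Module.finrank F C = k) (hne : ∃ c ∈ C, c ≠ 0)
    (hw : ∀ c ∈ C, c ≠ 0 → hammingNorm c = w) :
    HasParameters C k w ∧ IsOneWeight C := by
  obtain ⟨c, hc, hc0⟩ := hne
  refine ⟨⟨hk, ⟨c, hc, 0, C.zero_mem, hc0, by rw [hammingDist_zero_right, hw c hc hc0]⟩, ?_⟩, w, ?_⟩
  · rintro _ ⟨x, hx, y, hy, hxy, rfl⟩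
    rw [hammingDist_eq_hammingNorm, hw _ (C.add_mem (C.neg_mem hx) hy)]
    rwa [Ne, neg_add_eq_zero]
  · refine Set.eq_singleton_iff_unique_mem.2 ⟨⟨c, hc, hc0, hw c hc hc0⟩, ?_⟩
    rintro _ ⟨x, hx, hx0, rfl⟩
    exact hw x hx hx0

end code

/-! ### The three cases -/

/-- The BCH code attached to the largest coset leader, when the value of the Christoffel word is
`M * e` with `M = (q ^ m - 1) / (q ^ h - 1)` and `e` coprime to `(q ^ h - 1) / (q - 1)`. -/
theorem bchCodeHat_of_christoffelValue_eq {F : Type*} [Field F] [Fintype F] [DecidableEq F]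
    {K : Type*} [Field K] [Algebra F K] [FiniteDimensional F K] {q m h e M δ : ℕ}
    (hq : Fintype.card F = q) (hm : 2 ≤ m) (hh : 2 ≤ h)
    {α : K} (hα : IsPrimitiveRoot α (q ^ m - 1))
    (hδ : (q - 1) * δ + christoffelValue q m = q ^ m - 1)
    (hM : q ^ m - 1 = M * (q ^ h - 1)) (he : christoffelValue q m = M * e)
    (hcop : e.Coprime (∑ i ∈ Finset.range h, q ^ i)) :
    IsGreatest {i | IsCosetLeader q ((q ^ m - 1) / (q - 1)) i} δ ∧
      HasParameters (bchCodeHat F α q m (q - 1) δ) h (M * q ^ (h - 1)) ∧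
      IsOneWeight (bchCodeHat F α q m (q - 1) δ) := by
  have hq2 : 2 ≤ q := hq ▸ Fintype.one_lt_card
  have hqm : 1 < q ^ m := Nat.one_lt_pow (by omega) hq2
  have hqh : 1 < q ^ h := Nat.one_lt_pow (by omega) hq2
  have hn : (q - 1) * ((q ^ m - 1) / (q - 1)) = q ^ m - 1 :=
    Nat.mul_div_cancel' (by simpa using Nat.sub_dvd_pow_sub_pow q 1 m)
  have hN : (q - 1) * ∑ i ∈ Finset.range h, q ^ i = q ^ h - 1 := by
    rw [mul_comm]
    exact Nat.geomSum_eq hq2 h ▸ Nat.div_mul_cancel (by simpa using Nat.sub_dvd_pow_sub_pow q 1 h)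
  have hN1 : 1 < ∑ i ∈ Finset.range h, q ^ i := by
    obtain ⟨k, rfl⟩ := Nat.exists_eq_add_of_le' hh
    rw [Finset.sum_range_succ', Finset.sum_range_succ']
    have := pow_pos (by omega : 0 < q) (0 + 1)
    simp only [pow_zero]
    omega
  have hgr := isGreatest_isCosetLeader hq2 hm hn hδ
  refine ⟨hgr, ?_⟩
  change HasParameters (codeOfGenerator _ (bchGenerator F (α ^ (q - 1)) (δ + 1) 0)) _ _ ∧
    IsOneWeight (codeOfGenerator _ (bchGenerator F (α ^ (q - 1)) (δ + 1) 0))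
  set n := (q ^ m - 1) / (q - 1)
  have hn0 : 0 < n := Nat.pos_of_ne_zero fun h0 => by rw [h0, mul_zero] at hn; omega
  have := NeZero.of_pos hn0
  have hθ : IsPrimitiveRoot (α ^ (q - 1)) n := hα.pow (by omega) hn.symm
  have hβ : IsPrimitiveRoot (α ^ M) (q ^ h - 1) := hα.pow (by omega) hM
  have hη : ((α ^ (q - 1)) ^ δ)⁻¹ = (α ^ M) ^ e := by
    refine inv_eq_of_mul_eq_one_right ?_
    rw [← pow_mul, ← pow_mul, ← he, ← pow_add, hδ, hα.pow_eq_one]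
  obtain ⟨hk, hne, w, hw, hwn⟩ := bchCode_greatest_isCosetLeader hq hθ hgr (by
    rw [hη]
    exact fun z hz hz0 => exists_eq_algebraMap_mul_pow_of_mem_adjoin hq hN hN1 hβ hcop hz hz0)
  rw [hη, finrank_adjoin_pow hq hN hN1 hβ hcop] at hk hwn
  -- Double counting gives `w * (q ^ h - 1) = n * (q - 1) * q ^ (h - 1)`, and `n * (q - 1) = M * (q
  -- ^ h - 1)`.
  have hwM : w = M * q ^ (h - 1) := by
    refine Nat.eq_of_mul_eq_mul_right (by omega : 0 < q ^ h - 1) ?_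
    have h1 : q ^ h - q ^ (h - 1) = (q - 1) * q ^ (h - 1) := by
      rw [Nat.sub_mul, ← pow_succ', Nat.sub_add_cancel (by omega), one_mul]
    rw [hwn, h1, ← mul_assoc, mul_comm n, hn, hM]
    ring
  exact hwM ▸ isOneWeight_and_hasParameters hk hne hw

theorem theorem9 {F : Type*} [Field F] [Fintype F] [DecidableEq F]
    {K : Type*} [Field K] [Algebra F K]
    (q m a b : ℕ) (hq : Fintype.card F = q) (hq3 : 3 < q) (hmq : q ≤ m)
    (ha : 1 ≤ a) (hb : b ≤ q - 2) (hmab : m - 1 = a * (q - 1) + b)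
    (hK : Module.finrank F K = m)
    (α : K) (hα : IsPrimitiveRoot α (q ^ m - 1)) :
    (b = 0 →
      IsGreatest {i | IsCosetLeader q ((q ^ m - 1) / (q - 1)) i} (deltaZero q m a) ∧
      HasParameters (bchCodeHat F α q m (q - 1) (deltaZero q m a)) m (q ^ (m - 1)) ∧
      IsOneWeight (bchCodeHat F α q m (q - 1) (deltaZero q m a))) ∧
    (b = 1 → Even q →
      IsGreatest {i | IsCosetLeader q ((q ^ m - 1) / (q - 1)) i} (deltaOne q m a) ∧
      HasParameters (bchCodeHat F α q m (q - 1) (deltaOne q m a)) m (q ^ (m - 1)) ∧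
      IsOneWeight (bchCodeHat F α q m (q - 1) (deltaOne q m a))) ∧
    (b = 1 → Odd q →
      IsGreatest {i | IsCosetLeader q ((q ^ m - 1) / (q - 1)) i} (deltaOne q m a) ∧
      HasParameters (bchCodeHat F α q m (q - 1) (deltaOne q m a)) (m / 2)
        ((q ^ (m / 2) + 1) * q ^ (m / 2 - 1)) ∧
      IsOneWeight (bchCodeHat F α q m (q - 1) (deltaOne q m a))) := by
  have : FiniteDimensional F K := Module.finite_of_finrank_pos (by omega)
  refine ⟨?_, ?_, ?_⟩
  · rintro rfl
    have hm : m = a * (q - 1) + 1 := by omega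
    have h := bchCodeHat_of_christoffelValue_eq (M := 1) (h := m)
      (e := strideSum ℕ q a (q - 1)) hq (by omega) (by omega) hα (deltaZero_spec hq3 ha hm)
      (one_mul _).symm (by rw [christoffelValue_of_eq_add_one hm, one_mul])
      (by rw [hm]; exact coprime_strideSum_geomSum q a)
    rwa [one_mul] at h
  · rintro rfl ⟨A, hA⟩
    have hm : m = a * (q - 1) + 2 := by omega
    have h := bchCodeHat_of_christoffelValue_eq (M := 1) (h := m)
      hq (by omega) (by omega) hα (deltaOne_spec hq3 hm)
      (one_mul _).symm (one_mul _).symm (by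
        rw [christoffelValue_of_eq_add_two hm, hm, show (q - 1) / 2 = A - 1 by omega,
          show q - 1 - (A - 1) = A - 1 + 1 by omega, show q - 1 = 2 * (A - 1) + 1 by omega]
        exact coprime_strideSum_add_geomSum q a (A - 1))
    rwa [one_mul] at h
  · rintro rfl ⟨A, hA⟩
    have hm : m = a * (q - 1) + 2 := by omega
    have hA1 : q - 1 = 2 * A := by omega
    have hm2 : m = 2 * (a * A + 1) := by rw [hm, hA1]; ring
    have hmh : m / 2 = a * A + 1 := by omega
    have haA : 0 < a * A := Nat.mul_pos ha (by omega)
    rw [hmh]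
    -- For `q - 1 = 2 * A` the two halves of the Christoffel value are `S` and `q ^ (a * A + 1) * S`
    -- with `S = strideSum ℕ q a A`; hence `M = q ^ (m / 2) + 1` and `e = S`.
    refine bchCodeHat_of_christoffelValue_eq (e := strideSum ℕ q a A) hq (by omega) (by omega) hα
      (deltaOne_spec hq3 hm) ?_ ?_ (coprime_strideSum_geomSum q a)
    · rw [hm2, mul_comm 2, pow_mul, ← Nat.sq_sub_sq, one_pow]
    · rw [christoffelValue_of_eq_add_two hm, show (q - 1) / 2 = A by omega,
        show q - 1 - A = A by omega]
      ring
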